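/- Let $d\ge 1$ and $L\ge 2$ be integers. Consider the zero-temperature Edwards–Anderson model on the cube $\{0,1,\ldots,L\}^d$ with nearest-neighbour edges, i.i.d. standard Gaussian disorder $J=(J_e)_{e\in E}$ and Hamiltonian $H_J(\sigma)=-\sum_{\{i,j\}\in E}J_{ij}\sigma_i\sigma_j$, $\sigma\in\{-1,1\}^V$, with one of the following boundary conditions: (a) the spins at all vertices having some coordinate equal to $0$ or $L$ are fixed to a given deterministic configuration $\gamma$; (b) free boundary; (c) periodic boundary (opposite faces identified, free model on the resulting simple graph). A ground state in an environment is a minimizer of the Hamiltonian subject to the boundary condition. For $p\in(0,1)$, let $J^{(p)}_e=(1-p)J_e+\sqrt{2p-p^2}\,J'_e$, where $J'$ is an independent copy of $J$ (a perturbation of the first kind with parameter $p$). Let $\sigma$ and $\sigma'$ be ground states in the environments $J$ and $J^{(p)}$ respectively, let $A=\{i\in V:\sigma_i\ne\sigma'_i\}$ be the region of overturned spins, and let $\partial A$ be the set of edges from $A$ to $V\setminus A$. (Almost surely, ground states are unique in case (a), and unique up to a global sign in cases (b) and (c); $\partial A$ does not depend on that sign.) Then there are positive constants $C_1,C_2,C_3,C_4$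 depending only on $d$ such that, for all $L\ge 2$, all $p\in(0,1)$ and all these boundary conditions, $$\mathbb{P}\Bigl(|\partial A|\ge C_1(1-p)\sqrt{p}\,L^d(\log L)^{-1/2}\Bigr)\ \ge\ 1-3e^{-C_2pL^d}-C_3L^{-C_4}.$$ Moreover, when $p\gg L^{-1}$ the droplet boundary has dimension at least $d-\frac12>d-1$, in the following sense: for every $\varepsilon>0$ there is $K>0$, depending only on $d$ and $\varepsilon$, such that for all $L\ge2$, all $p\in(0,1)$ with $p\ge K/L$ and all these boundary conditions, $$\mathbb{P}\Bigl(|\partial A|\ge L^{d-\frac12}(\log L)^{-1/2}\Bigr)\ \ge\ 1-\varepsilon.$$ -/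

import Mathlib

open MeasureTheory ProbabilityTheory

/-- The product `σ i * σ j` of the two spins at the endpoints of the edge `{i, j}`, as a real
number. A spin configuration is a function `V → ℤˣ`, with `ℤˣ = {1, -1}`. -/
def spinProduct {V : Type*} (σ : V → ℤˣ) (e : Sym2 V) : ℝ :=
  Sym2.lift ⟨fun i j => (((σ i * σ j : ℤˣ) : ℤ) : ℝ), fun i j => by simp only [mul_comm]⟩ e

/-- The Edwards–Anderson Hamiltonian `H_J(σ) = -∑_{ {i,j} ∈ E } J_{ij} σ_i σ_j`. -/
def eaEnergy {V : Type*} (G : SimpleGraph V) [Fintype G.edgeSet] (J : G.edgeSet → ℝ)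
    (σ : V → ℤˣ) : ℝ :=
  -∑ e : G.edgeSet, J e * spinProduct σ (e : Sym2 V)

/-- The configurations which agree with `γ` on the boundary `B`. -/
def withBoundary {V : Type*} {B : Set V} (γ : B → ℤˣ) : Set (V → ℤˣ) :=
  {σ | ∀ i : B, σ i = γ i}

/-- `σ` is a ground state in the environment `J`: it minimizes the Hamiltonian among the admissible
configurations `S` (`S = Set.univ` in the absence of a boundary condition, and
`S = withBoundary γ` under the boundary condition `γ`). -/
def IsGroundState {V : Type*} (G : SimpleGraph V) [Fintype G.edgeSet] (S : Set (V → ℤˣ))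
    (J : G.edgeSet → ℝ) (σ : V → ℤˣ) : Prop :=
  σ ∈ S ∧ ∀ τ ∈ S, eaEnergy G J σ ≤ eaEnergy G J τ

/-- Ground states exist on every finite graph. -/
theorem exists_isGroundState {V : Type*} [Finite V] (G : SimpleGraph V) [Fintype G.edgeSet]
    {S : Set (V → ℤˣ)} (hS : S.Nonempty) (J : G.edgeSet → ℝ) :
    ∃ σ, IsGroundState G S J σ :=
  Set.exists_min_image S (eaEnergy G J) (Set.toFinite S) hS

/-- The environment after a perturbation of the first kind with parameter `p`:
`J_e` is replaced by `(1 - p) J_e + √(2p - p²) J'_e`. -/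
noncomputable def perturb {E : Type*} (p : ℝ) (J J' : E → ℝ) : E → ℝ :=
  fun e => (1 - p) * J e + √(2 * p - p ^ 2) * J' e

/-- The droplet: the region of overturned spins, where the configurations `σ` and `τ` disagree. -/
def overturned {V : Type*} (σ τ : V → ℤˣ) : Set V :=
  {i | σ i ≠ τ i}

/-- The edge boundary `∂A`: the set of edges from `A` to its complement. -/
def edgeBoundary {V : Type*} (G : SimpleGraph V) (A : Set V) : Set (Sym2 V) :=
  {e | e ∈ G.edgeSet ∧ ∃ i ∈ A, ∃ j ∉ A, e = s(i, j)}

/-- The joint law of `(J, J')`: all the `J_e` and `J'_e`, `e ∈ E`, are independent standard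
Gaussian random variables. -/
noncomputable def disorderLaw (E : Type*) [Fintype E] : Measure ((E → ℝ) × (E → ℝ)) :=
  (Measure.pi fun _ : E => gaussianReal 0 1).prod (Measure.pi fun _ : E => gaussianReal 0 1)

/-- The probability that `|∂A| ≥ x`, where `A` is the region in which the ground states of the
environments `J` and `perturb p J J'` disagree. With a boundary condition the two ground states are
almost surely unique, and without one they are almost surely unique up to a global sign, on which
`∂A` does not depend; the event requires the inequality for every choice of the ground states. -/
noncomputable def dropletProb {V : Type*} (G : SimpleGraph V) [Fintype G.edgeSet]
    (S : Set (V → ℤˣ)) (p x : ℝ) : ℝ :=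
  (disorderLaw G.edgeSet).real {ω | ∀ σ τ : V → ℤˣ, IsGroundState G S ω.1 σ →
    IsGroundState G S (perturb p ω.1 ω.2) τ →
      x ≤ ((edgeBoundary G (overturned σ τ)).ncard : ℝ)}

/-- The cube `{0, 1, …, L}^d` with its nearest-neighbour edges. -/
def cubeGraph (d L : ℕ) : SimpleGraph (Fin d → Fin (L + 1)) :=
  SimpleGraph.fromRel fun x y => ∃ k, (y k : ℕ) = (x k : ℕ) + 1 ∧ ∀ j, j ≠ k → y j = x j

/-- The usual boundary of the cube: the vertices with at least one coordinate equal to `0` or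
`L`. -/
def cubeBoundary (d L : ℕ) : Set (Fin d → Fin (L + 1)) :=
  {x | ∃ k, (x k : ℕ) = 0 ∨ (x k : ℕ) = L}

/-- The cube `{0, 1, …, L}^d` with opposite faces identified, as a simple graph: the vertices are
`{0, …, L - 1}^d`, and nearest neighbours are taken modulo `L`. -/
def torusGraph (d L : ℕ) : SimpleGraph (Fin d → Fin L) :=
  SimpleGraph.fromRel fun x y => ∃ k, (y k : ℕ) = ((x k : ℕ) + 1) % L ∧ ∀ j, j ≠ k → y j = x j

/-- The boundary conditions on `{0, 1, …, L}^d`: a given configuration `γ` on the usual boundary,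
free, or periodic. -/
inductive CubeBC (d L : ℕ) : Type
  | fixed (γ : cubeBoundary d L → ℤˣ)
  | free
  | periodic

open scoped Classical in
/-- The probability that `|∂A| ≥ x` for the Edwards–Anderson model on `{0, 1, …, L}^d` with the
given boundary condition and a perturbation of the first kind with parameter `p`. -/
noncomputable def cubeDropletProb {d L : ℕ} (bc : CubeBC d L) (p x : ℝ) : ℝ :=
  match bc with
  | .fixed γ => dropletProb (cubeGraph d L) (withBoundary γ) p x
  | .free => dropletProb (cubeGraph d L) Set.univ p x
  | .periodic => dropletProb (torusGraph d L) Set.univ p x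

/-! Write `s = √(2p - p²)`. The pair of `J^(p) = (1-p)J + sJ'` and `J'' = -sJ + (1-p)J'` is a
rotation of `(J, J')`, hence has the same law, and `J = (1-p)J^(p) - sJ''`. Let `σ`, `τ` be ground
states for `J`, `J^(p)`. By linearity of the energy, the sum of the two energy gaps `[H_J(τ) -
H_J(σ)] + [H_{J^(p)}(σ) - H_{J^(p)}(τ)]` equals `-p H_J(σ) - p H_{J^(p)}(τ) + s H_{J'}(σ) - s
H_{J''}(τ)`.

Both ground state energies are at most `-a` with `a` of order `L^d` (`exists_energy_le_matching`,
`exists_gaussianPi_abs_sum_tail`). Since `σ` depends only on `J`, which is independent of `J'`, the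
term `H_{J'}(σ)` is Gaussian with variance `|E|`; likewise `H_{J''}(τ)`. So each of the last two
terms is at least `-pa/2` outside an event of probability `exp(-const * p L^d)`
(`groundState_energy_tail`), and the sum of the gaps is at least `pa`.

Conversely, only edges of `∂A` contribute to that sum, each at most `2 max |J - J^(p)|`, which is of
order `√p √(log L)` (`energy_difference_le`, `gaussianPi_sup_tail`). Dividing gives `|∂A|` of order
at least `√p L^d / √(log L)`. The argument is assembled in `le_ncard_edgeBoundary` and
`le_dropletProb`; the rest is counting edges in the box. The factor `1 - p` of the theorem is not
needed. -/

/-! ### Gaussian vectors: linear forms, maxima, sums of absolute values, rotations -/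

/-- The law of a family of independent standard Gaussian random variables. -/
noncomputable abbrev gaussianPi (E : Type*) [Fintype E] : Measure (E → ℝ) :=
  Measure.pi fun _ : E => gaussianReal 0 1

theorem gaussianPi_map_linear {E : Type*} [Fintype E] (c : E → ℝ) :
    (gaussianPi E).map (fun J => ∑ e, c e * J e) =
      gaussianReal 0 (∑ e, c e ^ 2).toNNReal := by
  apply Measure.ext_of_charFun
  ext t
  rw [charFun_apply_real, integral_map (Measurable.aemeasurable (by fun_prop)) (by fun_prop),
    charFun_gaussianReal]
  have h : ∀ J : E → ℝ, Complex.exp (t * ((∑ e, c e * J e : ℝ) : ℂ) * Complex.I) =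
      ∏ e, Complex.exp (((t * c e : ℝ) : ℂ) * (J e : ℂ) * Complex.I) := by
    intro J
    rw [← Complex.exp_sum]
    congr 1
    push_cast
    rw [Finset.mul_sum, Finset.sum_mul]
    exact Finset.sum_congr rfl fun e _ => by ring
  simp_rw [h]
  rw [integral_fintype_prod_eq_prod
    (f := fun e (x : ℝ) => Complex.exp (((t * c e : ℝ) : ℂ) * (x : ℂ) * Complex.I))]
  have h2 : ∀ e, ∫ x, Complex.exp (((t * c e : ℝ) : ℂ) * (x : ℂ) * Complex.I) ∂(gaussianReal 0 1) =
      Complex.exp (-((t * c e : ℝ) : ℂ) ^ 2 / 2) := by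
    intro e
    rw [← charFun_apply_real, charFun_gaussianReal]
    simp
    ring_nf
  simp_rw [h2]
  rw [← Complex.exp_sum]
  congr 1
  rw [Real.coe_toNNReal _ (Finset.sum_nonneg fun e _ => sq_nonneg (c e))]
  push_cast
  rw [Finset.sum_mul, Finset.sum_div]
  simp [← Finset.sum_neg_distrib]
  refine Finset.sum_congr rfl fun e _ => ?_
  ring

theorem gaussianPi_linear_tail {E : Type*} [Fintype E] {c : E → ℝ} (hc : ∀ e, |c e| ≤ 1)
    {N x : ℝ} (hN : (Fintype.card E : ℝ) ≤ N) (hN0 : 0 < N) (hx : 0 ≤ x) :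
    (gaussianPi E).real {J | x ≤ ∑ e, c e * J e} ≤ Real.exp (-(x ^ 2 / (2 * N))) := by
  have hmap := gaussianPi_map_linear c
  have hint : Integrable (fun J : E → ℝ => Real.exp (x / N * ∑ e, c e * J e)) (gaussianPi E) := by
    have h := integrable_exp_mul_gaussianReal (μ := 0)
      (v := (∑ e, c e ^ 2).toNNReal) (x / N)
    rw [← hmap] at h
    exact h.comp_measurable (by fun_prop)
  -- The exponent `x / N` optimises the Chernoff bound for variance `N`.
  refine (measure_ge_le_exp_mul_mgf x (div_nonneg hx hN0.le) hint).trans ?_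
  rw [mgf_gaussianReal hmap, ← Real.exp_add]
  apply Real.exp_le_exp.2
  have hs : ∑ e, c e ^ 2 ≤ N := by
    refine le_trans ?_ hN
    calc ∑ e, c e ^ 2 ≤ ∑ _e : E, (1 : ℝ) :=
          Finset.sum_le_sum fun e _ => (sq_le_one_iff_abs_le_one _).2 (hc e)
      _ = Fintype.card E := by simp
  rw [Real.coe_toNNReal _ (Finset.sum_nonneg fun e _ => sq_nonneg (c e)), zero_mul, zero_add]
  have h1 : (∑ e, c e ^ 2) * (x / N) ^ 2 / 2 ≤ N * (x / N) ^ 2 / 2 := by gcongr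
  have h2 : -(x / N) * x + N * (x / N) ^ 2 / 2 = -(x ^ 2 / (2 * N)) := by
    field_simp
    ring
  linarith

/-- The linear form is Gaussian with positive variance, so its law has no atom. This is the source
of the uniqueness of ground states. -/
theorem gaussianPi_hyperplane_null {E : Type*} [Fintype E] {c : E → ℝ} (hc : c ≠ 0) :
    ∀ᵐ J ∂gaussianPi E, ∑ e, c e * J e ≠ 0 := by
  obtain ⟨e₀, he₀⟩ := Function.ne_iff.1 hc
  have hpos : 0 < ∑ e, c e ^ 2 :=
    Finset.sum_pos' (fun e _ => sq_nonneg (c e)) ⟨e₀, Finset.mem_univ _, by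
      have : c e₀ ≠ 0 := he₀
      positivity⟩
  have hv : (∑ e, c e ^ 2).toNNReal ≠ 0 := (Real.toNNReal_pos.2 hpos).ne'
  have := nullSingletonClass_gaussianReal (μ := 0) hv
  have h0 : (gaussianReal 0 (∑ e, c e ^ 2).toNNReal) {(0 : ℝ)} = 0 := measure_singleton 0
  rw [← gaussianPi_map_linear c, Measure.map_apply (by fun_prop) (measurableSet_singleton _)] at h0
  exact measure_eq_zero_iff_ae_notMem.1 h0

theorem gaussianPi_sup_tail {E : Type*} [Fintype E] {N t : ℝ} (hN : (Fintype.card E : ℝ) ≤ N)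
    (ht : 0 ≤ t) :
    (gaussianPi E).real {J | ∃ e, t ≤ |J e|} ≤ N * (2 * Real.exp (-(t ^ 2 / 2))) := by
  classical
  have hone : ∀ (e : E) (r : ℝ), |r| ≤ 1 →
      (gaussianPi E).real {J | t ≤ r * J e} ≤ Real.exp (-(t ^ 2 / 2)) := by
    intro e r hr
    have hm : (gaussianPi E).map (fun J => J e) = gaussianReal 0 1 :=
      (measurePreserving_eval (fun _ : E => gaussianReal 0 1) e).map_eq
    have h1 : (gaussianPi E).real {J | t ≤ r * J e} = (gaussianReal 0 1).real {x | t ≤ r * x} := by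
      rw [← hm, map_measureReal_apply (by fun_prop) (measurableSet_le (by fun_prop) (by fun_prop))]
      rfl
    have hm' : (gaussianPi Unit).map (fun J => J ()) = gaussianReal 0 1 :=
      (measurePreserving_eval (fun _ : Unit => gaussianReal 0 1) ()).map_eq
    rw [h1, ← hm', map_measureReal_apply (by fun_prop)
      (measurableSet_le (by fun_prop) (by fun_prop))]
    have := gaussianPi_linear_tail (E := Unit) (c := fun _ => r) (fun _ => hr)
      (N := 1) (x := t) (by simp) one_pos ht
    simpa using this
  calc (gaussianPi E).real {J | ∃ e, t ≤ |J e|}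
      ≤ (gaussianPi E).real (⋃ e, {J : E → ℝ | t ≤ |J e|}) :=
        measureReal_mono (fun J hJ => by simpa using hJ)
    _ ≤ ∑ e, (gaussianPi E).real {J : E → ℝ | t ≤ |J e|} := measureReal_iUnion_fintype_le _
    _ ≤ ∑ _e : E, (2 * Real.exp (-(t ^ 2 / 2))) := by
        refine Finset.sum_le_sum fun e _ => ?_
        have hsub : {J : E → ℝ | t ≤ |J e|} ⊆ {J | t ≤ 1 * J e} ∪ {J | t ≤ (-1) * J e} := by
          intro J hJ
          rcases le_abs.1 (show t ≤ |J e| from hJ) with h | h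
          · left; simpa using h
          · right; simpa using h
        refine (measureReal_mono hsub).trans ((measureReal_union_le _ _).trans ?_)
        have := hone e 1 (by simp)
        have := hone e (-1) (by simp)
        linarith
    _ = Fintype.card E * (2 * Real.exp (-(t ^ 2 / 2))) := by simp
    _ ≤ _ := by gcongr

/-- A lower-tail bound for sums of absolute values of independent standard Gaussians. -/
theorem exists_gaussianPi_abs_sum_tail : ∃ c : ℝ, 0 < c ∧ ∀ (E : Type) [Fintype E] (M : Finset E),
    (gaussianPi E).real {J | ∑ e ∈ M, |J e| ≤ c * M.card} ≤ Real.exp (-(c * M.card)) := by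
  set ρ : ℝ := ∫ x, Real.exp (-|x|) ∂(gaussianReal 0 1) with hρ
  have hint : Integrable (fun x : ℝ => Real.exp (-|x|)) (gaussianReal 0 1) := by
    refine Integrable.of_bound (by fun_prop) 1 (Filter.Eventually.of_forall fun x => ?_)
    rw [Real.norm_of_nonneg (Real.exp_pos _).le]
    exact Real.exp_le_one_iff.2 (by simp)
  have hρ0 : 0 < ρ := integral_exp_pos hint
  have hρ1 : ρ < 1 := by
    have h1 : 0 < ∫ x, (1 - Real.exp (-|x|)) ∂(gaussianReal 0 1) := by
      rw [integral_pos_iff_support_of_nonneg]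
      · have hs : Function.support (fun x : ℝ => 1 - Real.exp (-|x|)) = {0}ᶜ := by
          ext x
          rw [Function.mem_support, sub_ne_zero, ne_comm, Ne, Real.exp_eq_one_iff]
          simp
        have := nullSingletonClass_gaussianReal (μ := 0) (one_ne_zero (α := NNReal))
        rw [hs, prob_compl_eq_one_sub (measurableSet_singleton 0), measure_singleton]
        simp
      · intro x
        simp
      · exact (integrable_const 1).sub hint
    rw [integral_sub (integrable_const 1) hint] at h1
    simpa using h1
  -- With `ρ = exp(-2c)`, the Chernoff bound at exponent `-1` is `exp(c|M|) ρ^|M| = exp(-c|M|)`.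
  refine ⟨-Real.log ρ / 2, by have := Real.log_neg hρ0 hρ1; linarith, ?_⟩
  intro E _ M
  classical
  set c := -Real.log ρ / 2
  have hI : Integrable (fun J : E → ℝ => Real.exp ((-1) * ∑ e ∈ M, |J e|)) (gaussianPi E) := by
    refine Integrable.of_bound (Continuous.aestronglyMeasurable (by fun_prop)) 1
      (Filter.Eventually.of_forall fun J => ?_)
    rw [Real.norm_of_nonneg (Real.exp_pos _).le]
    refine Real.exp_le_one_iff.2 ?_
    have := Finset.sum_nonneg fun e (_ : e ∈ M) => abs_nonneg (J e)
    linarith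
  refine (measure_le_le_exp_mul_mgf (c * M.card) (by norm_num) hI).trans ?_
  have hmgf : mgf (fun J : E → ℝ => ∑ e ∈ M, |J e|) (gaussianPi E) (-1) = ρ ^ M.card := by
    have h : ∀ J : E → ℝ, Real.exp (-1 * ∑ e ∈ M, |J e|) =
        ∏ e, (if e ∈ M then Real.exp (-|J e|) else 1) := by
      intro J
      rw [Finset.prod_ite_mem, Finset.univ_inter, ← Real.exp_sum, Finset.sum_neg_distrib]
      simp
    simp only [mgf]
    simp_rw [h]
    rw [integral_fintype_prod_eq_prod (f := fun e (x : ℝ) => if e ∈ M then Real.exp (-|x|) else 1)]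
    have h2 : ∀ e, ∫ x, (if e ∈ M then Real.exp (-|x|) else 1) ∂(gaussianReal 0 1) =
        if e ∈ M then ρ else 1 := by
      intro e
      split_ifs <;> simp [hρ]
    simp_rw [h2]
    simp [Finset.prod_ite_mem]
  rw [hmgf]
  have : ρ ^ M.card = Real.exp (-(2 * c) * M.card) := by
    rw [mul_comm, Real.exp_nat_mul]
    congr 1
    rw [show -(2 * c) = Real.log ρ by simp [c]; ring, Real.exp_log hρ0]
  rw [this, ← Real.exp_add]
  apply le_of_eq
  congr 1
  ring

/-- Makes the rotation invariance of pairs of independent centred Gaussian vectors applicable. -/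
instance isGaussian_gaussianPi (E : Type*) [Fintype E] : IsGaussian (gaussianPi E) := by
  have h := iIndepFun.hasGaussianLaw (P := gaussianPi E) (X := fun (e : E) (J : E → ℝ) => J e)
    (fun e => ⟨by
      rw [(measurePreserving_eval (fun _ : E => gaussianReal 0 1) e).map_eq]
      infer_instance⟩)
    (iIndepFun_pi (X := fun _ x => x) fun _ => by fun_prop)
  simpa using h.isGaussian_map

/-- The rotation of `(J, J')` which takes `J` to its perturbation preserves the joint law. -/
theorem measurePreserving_perturb {E : Type*} [Fintype E] {p : ℝ} (hp : 0 < p) (hp1 : p < 1) :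
    MeasurePreserving (fun ω : (E → ℝ) × (E → ℝ) =>
      (perturb p ω.1 ω.2, (-√(2 * p - p ^ 2)) • ω.1 + (1 - p) • ω.2))
      (disorderLaw E) (disorderLaw E) := by
  have hmean : (gaussianPi E)[id] = 0 := by
    ext e
    have hi : ∀ e, Integrable (fun J : E → ℝ => (id J : E → ℝ) e) (gaussianPi E) := fun e =>
      ((measurePreserving_eval (fun _ : E => gaussianReal 0 1) e).integrable_comp
        (by fun_prop)).2 IsGaussian.integrable_id
    rw [eval_integral hi]
    have := (measurePreserving_eval (fun _ : E => gaussianReal 0 1) e).map_eq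
    have h2 : ∫ x, x ∂((gaussianPi E).map (Function.eval e)) = 0 := by
      rw [this, integral_id_gaussianReal]
    rwa [integral_map (measurable_pi_apply e).aemeasurable (by fun_prop)] at h2
  -- The angle has cosine `1 - p` and sine `√(1 - (1 - p)²) = √(2p - p²)`.
  have h := IsGaussian.map_rotation_eq_self hmean (Real.arccos (1 - p))
  have hf : (fun ω : (E → ℝ) × (E → ℝ) =>
      (perturb p ω.1 ω.2, (-√(2 * p - p ^ 2)) • ω.1 + (1 - p) • ω.2)) =
      ContinuousLinearMap.rotation (Real.arccos (1 - p)) := by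
    ext ω e
    all_goals
      simp only [ContinuousLinearMap.rotation_apply, Real.sin_arccos,
        Real.cos_arccos (show -1 ≤ 1 - p by linarith) (show 1 - p ≤ 1 by linarith),
        show 1 - (1 - p) ^ 2 = 2 * p - p ^ 2 by ring, perturb]
    simp
  rw [hf]
  exact ⟨by fun_prop, h⟩

/-! ### Energies, boundaries of droplets and matchings -/

theorem spinProduct_mk {V : Type*} (σ : V → ℤˣ) (i j : V) :
    spinProduct σ s(i, j) = ((σ i : ℤ) : ℝ) * ((σ j : ℤ) : ℝ) := by
  simp [spinProduct]

theorem abs_spinProduct {V : Type*} (σ : V → ℤˣ) (e : Sym2 V) : |spinProduct σ e| = 1 := by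
  induction e with
  | _ i j =>
    rw [spinProduct_mk]
    rcases Int.units_eq_one_or (σ i) with h | h <;> rcases Int.units_eq_one_or (σ j) with h' | h' <;>
      simp [h, h']

theorem mem_edgeBoundary_overturned {V : Type*} {G : SimpleGraph V} {σ τ : V → ℤˣ} {e : Sym2 V}
    (he : e ∈ G.edgeSet) (h : spinProduct σ e ≠ spinProduct τ e) :
    e ∈ edgeBoundary G (overturned σ τ) := by
  refine ⟨he, ?_⟩
  induction e with
  | _ i j =>
    rw [spinProduct_mk, spinProduct_mk] at h
    by_cases hi : σ i = τ i <;> by_cases hj : σ j = τ j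
    · simp [hi, hj] at h
    · exact ⟨j, hj, i, fun hn => hn hi, Sym2.eq_swap⟩
    · exact ⟨i, hi, j, fun hn => hn hj, rfl⟩
    · exfalso
      rw [Int.units_ne_iff_eq_neg.1 hi, Int.units_ne_iff_eq_neg.1 hj] at h
      simp at h

theorem eaEnergy_perturb {V : Type*} (G : SimpleGraph V) [Fintype G.edgeSet]
    (J K : G.edgeSet → ℝ) (a b : ℝ) (σ : V → ℤˣ) :
    eaEnergy G (fun e => a * J e + b * K e) σ = a * eaEnergy G J σ + b * eaEnergy G K σ := by
  simp only [eaEnergy, mul_neg, Finset.mul_sum, ← neg_add, ← Finset.sum_add_distrib]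
  congr 1
  exact Finset.sum_congr rfl fun e _ => by ring

/-- The energy differences between two configurations in two environments are controlled by the
boundary of the region of disagreement. -/
theorem energy_difference_le {V : Type*} [Finite V] (G : SimpleGraph V) [Fintype G.edgeSet]
    (J K : G.edgeSet → ℝ) (σ τ : V → ℤˣ) {b : ℝ} (hb : ∀ e, |J e - K e| ≤ b) :
    eaEnergy G J τ - eaEnergy G J σ + (eaEnergy G K σ - eaEnergy G K τ) ≤
      2 * b * ((edgeBoundary G (overturned σ τ)).ncard : ℝ) := by
  classical
  have h1 : eaEnergy G J τ - eaEnergy G J σ + (eaEnergy G K σ - eaEnergy G K τ) =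
      ∑ e : G.edgeSet, (J e - K e) * (spinProduct σ (e : Sym2 V) - spinProduct τ (e : Sym2 V)) := by
    simp only [eaEnergy]
    simp only [mul_sub, sub_mul, Finset.sum_sub_distrib]
    ring
  set D : Finset G.edgeSet :=
    Finset.univ.filter fun e => spinProduct σ (e : Sym2 V) ≠ spinProduct τ (e : Sym2 V) with hD
  have hcard : (D.card : ℝ) ≤ ((edgeBoundary G (overturned σ τ)).ncard : ℝ) := by
    have h2 : (D.image (fun e : G.edgeSet => (e : Sym2 V))).card = D.card :=
      Finset.card_image_of_injective _ Subtype.val_injective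
    refine Nat.cast_le.2 ?_
    rw [← h2, ← Set.ncard_coe_finset]
    refine Set.ncard_le_ncard ?_ (Set.toFinite (edgeBoundary G (overturned σ τ)))
    intro e he
    simp only [hD, Finset.coe_image, Set.mem_image, Finset.mem_coe, Finset.mem_filter,
      Finset.mem_univ, true_and] at he
    obtain ⟨e', he', rfl⟩ := he
    exact mem_edgeBoundary_overturned e'.2 he'
  have hterm : ∀ e : G.edgeSet,
      (J e - K e) * (spinProduct σ (e : Sym2 V) - spinProduct τ (e : Sym2 V)) ≤
        if e ∈ D then 2 * b else 0 := by
    intro e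
    split_ifs with he
    · have ha : |spinProduct σ (e : Sym2 V) - spinProduct τ (e : Sym2 V)| ≤ 2 := by
        refine (abs_sub _ _).trans ?_
        rw [abs_spinProduct, abs_spinProduct]
        norm_num
      refine (le_abs_self _).trans ?_
      rw [abs_mul, mul_comm 2 b]
      exact mul_le_mul (hb e) ha (abs_nonneg _) ((abs_nonneg _).trans (hb e))
    · have : spinProduct σ (e : Sym2 V) = spinProduct τ (e : Sym2 V) := by simpa [hD] using he
      simp [this]
  rw [h1]
  by_cases hne : D.Nonempty
  · have hb0 : 0 ≤ b := by
      obtain ⟨e, _⟩ := hne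
      exact (abs_nonneg _).trans (hb e)
    calc _ ≤ ∑ e : G.edgeSet, if e ∈ D then 2 * b else 0 := Finset.sum_le_sum fun e _ => hterm e
      _ = 2 * b * D.card := by simp [Finset.sum_ite_mem, mul_comm]
      _ ≤ _ := by gcongr
  · have hD0 : D = ∅ := Finset.not_nonempty_iff_eq_empty.1 hne
    -- Any edge forces `b ≥ 0`; without edges `b` may be negative, but then the boundary is empty.
    rcases isEmpty_or_nonempty G.edgeSet with hE | ⟨⟨e⟩⟩
    · have : edgeBoundary G (overturned σ τ) = ∅ := by
        ext e
        simp only [Set.mem_empty_iff_false, iff_false]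
        exact fun h => hE.false ⟨e, h.1⟩
      simp [this]
    · have hb0 : 0 ≤ b := (abs_nonneg _).trans (hb e)
      refine (Finset.sum_nonpos fun e _ => ?_).trans (by positivity)
      simpa [hD0] using hterm e

/-- Averaging over independent uniform signs attached to the classes of a matching. -/
theorem exists_energy_le_matching {V : Type*} [Fintype V] [DecidableEq V] (G : SimpleGraph V)
    [Fintype G.edgeSet] (B : Set V) [DecidablePred (· ∈ B)] (γ : V → ℤˣ) (r : V → V)
    (hr : ∀ i, r (r i) = r i) (hfib : ∀ i j, r i = r j → i = j ∨ j = r i ∨ i = r j)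
    (M : Finset G.edgeSet)
    (hM : ∀ e : G.edgeSet, e ∈ M ↔ ∃ i, i ∉ B ∧ r i ∉ B ∧ (e : Sym2 V) = s(i, r i))
    (J : G.edgeSet → ℝ) :
    ∃ σ : V → ℤˣ, (∀ i ∈ B, σ i = γ i) ∧
      eaEnergy G J σ ≤ -∑ e ∈ M, |J e| -
        ∑ e : G.edgeSet, (if ∀ v ∈ (e : Sym2 V), v ∈ B then spinProduct γ (e : Sym2 V) else 0) *
          J e := by
  classical
  set c : G.edgeSet → ℝ := fun e =>
    if ∀ v ∈ (e : Sym2 V), v ∈ B then spinProduct γ (e : Sym2 V) else 0 with hc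
  set sgn : ℝ → ℤˣ := fun x => if 0 ≤ x then 1 else -1 with hsgn
  have hsgn_mul : ∀ x : ℝ, x * ((sgn x : ℤ) : ℝ) = |x| := by
    intro x
    by_cases hx : 0 ≤ x
    · simp [hsgn, hx, abs_of_nonneg hx]
    · simp [hsgn, hx, abs_of_neg (not_le.1 hx)]
  -- Relative sign of `i` and its root that satisfies the edge joining them; a root itself gets sign
  -- `1`, as there are no loops.
  set s : V → ℤˣ := fun i => if h : s(i, r i) ∈ G.edgeSet then sgn (J ⟨_, h⟩) else 1 with hs
  have hs_root : ∀ i, r i = i → s i = 1 := by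
    intro i hi
    simp [hs, hi]
  set σ : (V → ℤˣ) → V → ℤˣ := fun τ i => if i ∈ B then γ i else s i * τ (r i) with hσ
  -- Flipping `τ` at `r i` reverses the spin at `i` and leaves the one at `j` alone, so the average
  -- vanishes.
  have hzero : ∀ i j, i ∉ B → (j ∈ B ∨ r j ≠ r i) → ∑ τ, spinProduct (σ τ) s(i, j) = 0 := by
    intro i j hi hj
    have hflip := Equiv.sum_comp (Equiv.mulLeft (Pi.mulSingle (r i) (-1) : V → ℤˣ))
      (fun τ => spinProduct (σ τ) s(i, j))
    have hneg : ∀ τ : V → ℤˣ,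
        spinProduct (σ (Equiv.mulLeft (Pi.mulSingle (r i) (-1) : V → ℤˣ) τ)) s(i, j) =
          -spinProduct (σ τ) s(i, j) := by
      intro τ
      rw [spinProduct_mk, spinProduct_mk]
      rcases hj with hj | hj
      · simp [hσ, hi, hj]
      · simp [hσ, hi, Pi.mulSingle_eq_of_ne hj]
    simp_rw [hneg] at hflip
    rw [Finset.sum_neg_distrib] at hflip
    linarith
  -- Matched edges contribute `|J e|` for every `τ`, edges inside `B` contribute their fixed value,
  -- and all others average to zero.
  have hsum : ∀ e : G.edgeSet, ∑ τ : V → ℤˣ, J e * spinProduct (σ τ) (e : Sym2 V) =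
      (Fintype.card (V → ℤˣ) : ℝ) * ((if e ∈ M then |J e| else 0) + c e * J e) := by
    rintro ⟨e, he⟩
    induction e with
    | _ i j =>
    have hij : i ≠ j := G.ne_of_adj he
    have hcB : c ⟨s(i, j), he⟩ = if i ∈ B ∧ j ∈ B then spinProduct γ s(i, j) else 0 := by
      simp [hc]
    have hMB : ∀ i j (he : s(i, j) ∈ G.edgeSet), j ∈ B → (⟨s(i, j), he⟩ : G.edgeSet) ∉ M := by
      intro i j he hj hmem
      obtain ⟨k, hk, hk', hek⟩ := (hM _).1 hmem
      have : j ∈ s(k, r k) := by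
        rw [← hek]
        exact Sym2.mem_mk_right i j
      rcases Sym2.mem_iff.1 this with h | h <;> subst h <;> contradiction
    by_cases hi : i ∈ B <;> by_cases hj : j ∈ B
    · rw [if_neg (hMB i j he hj), hcB, if_pos ⟨hi, hj⟩]
      simp only [spinProduct_mk, hσ, hi, hj, if_true]
      simp
      ring
    · have hne : (⟨s(i, j), he⟩ : G.edgeSet) ∉ M := by
        have h := hMB j i (by rwa [Sym2.eq_swap]) hi
        simpa only [Sym2.eq_swap] using h
      rw [if_neg hne, hcB, if_neg (c := i ∈ B ∧ j ∈ B) (fun h => hj h.2), ← Finset.mul_sum]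
      have := hzero j i hj (Or.inl hi)
      rw [Sym2.eq_swap] at this
      simp [this]
    · rw [if_neg (hMB i j he hj), hcB, if_neg (c := i ∈ B ∧ j ∈ B) (fun h => hi h.1),
        ← Finset.mul_sum, hzero i j hi (Or.inl hj)]
      simp
    · rw [hcB, if_neg (c := i ∈ B ∧ j ∈ B) (fun h => hi h.1)]
      by_cases hrij : r i = r j
      · have key : ∀ i j (he : s(i, j) ∈ G.edgeSet), i ∉ B → j ∉ B → r i = r j → j = r i →
            ∑ τ : V → ℤˣ, J ⟨s(i, j), he⟩ * spinProduct (σ τ) s(i, j) =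
            (Fintype.card (V → ℤˣ) : ℝ) *
              ((if (⟨s(i, j), he⟩ : G.edgeSet) ∈ M then |J ⟨s(i, j), he⟩| else 0) +
                0 * J ⟨s(i, j), he⟩) := by
          rintro i j he hi hj hrij rfl
          rw [if_pos ((hM _).2 ⟨i, hi, hj, rfl⟩)]
          have h1 : ∀ τ : V → ℤˣ, J ⟨s(i, r i), he⟩ * spinProduct (σ τ) s(i, r i) =
              |J ⟨s(i, r i), he⟩| := by
            intro τ
            rw [spinProduct_mk, ← hsgn_mul]
            have hsi : s i = sgn (J ⟨s(i, r i), he⟩) := by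
              simp only [hs, dif_pos he]
            simp only [hσ, hi, hj, if_false, hs_root (r i) (hr i), hsi, hr i]
            rcases Int.units_eq_one_or (τ (r i)) with h | h <;> simp [h]
          simp [h1]
        rcases hfib i j hrij with h | h | h
        · exact absurd h hij
        · exact key i j he hi hj hrij h
        · have := key j i (by rwa [Sym2.eq_swap]) hj hi hrij.symm h
          simpa only [Sym2.eq_swap] using this
      · have hne : (⟨s(i, j), he⟩ : G.edgeSet) ∉ M := by
          intro hmem
          obtain ⟨k, _, _, hek⟩ := (hM _).1 hmem
          rcases Sym2.eq_iff.1 (show s(i, j) = s(k, r k) from hek) with ⟨rfl, rfl⟩ | ⟨rfl, rfl⟩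
          · exact hrij (hr _).symm
          · exact hrij (hr _)
        rw [if_neg hne, ← Finset.mul_sum, hzero i j hi (Or.inr (Ne.symm hrij))]
        simp
  have havg : ∑ τ : V → ℤˣ, eaEnergy G J (σ τ) ≤
      ∑ _τ : V → ℤˣ, (-∑ e ∈ M, |J e| - ∑ e, c e * J e) := by
    simp only [eaEnergy]
    rw [Finset.sum_neg_distrib, Finset.sum_comm, Finset.sum_congr rfl fun e _ => hsum e,
      ← Finset.mul_sum, Finset.sum_add_distrib]
    rw [Finset.sum_const, Finset.card_univ, nsmul_eq_mul]
    simp only [Finset.sum_ite_mem, Finset.univ_inter]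
    apply le_of_eq
    ring
  obtain ⟨τ, _, hτ⟩ := Finset.exists_le_of_sum_le Finset.univ_nonempty havg
  exact ⟨σ τ, fun i hi => by simp [hσ, hi], hτ⟩

/-! ### Ground states seen from an independent environment -/

instance isProbabilityMeasure_disorderLaw (E : Type*) [Fintype E] :
    IsProbabilityMeasure (disorderLaw E) :=
  inferInstanceAs (IsProbabilityMeasure ((gaussianPi E).prod (gaussianPi E)))

theorem measurable_eaEnergy {V : Type*} (G : SimpleGraph V) [Fintype G.edgeSet] (σ : V → ℤˣ) :
    Measurable fun J : G.edgeSet → ℝ => eaEnergy G J σ := by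
  unfold eaEnergy
  fun_prop

theorem measurableSet_isGroundState {V : Type*} [Finite V] (G : SimpleGraph V) [Fintype G.edgeSet]
    (S : Set (V → ℤˣ)) (σ : V → ℤˣ) :
    MeasurableSet {J : G.edgeSet → ℝ | IsGroundState G S J σ} := by
  have h : {J : G.edgeSet → ℝ | IsGroundState G S J σ} =
      {_J | σ ∈ S} ∩ ⋂ τ : S, {J | eaEnergy G J σ ≤ eaEnergy G J τ} := by
    ext J
    simp [IsGroundState]
  rw [h]
  refine (MeasurableSet.const _).inter (MeasurableSet.iInter fun τ => ?_)
  exact measurableSet_le (measurable_eaEnergy G σ) (measurable_eaEnergy G τ)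

/-- Almost surely, configurations with equal energies have equal spin products. -/
theorem ae_spinProduct_eq_of_eaEnergy_eq {V : Type*} [Finite V] (G : SimpleGraph V)
    [Fintype G.edgeSet] :
    ∀ᵐ J ∂gaussianPi G.edgeSet, ∀ σ τ : V → ℤˣ, eaEnergy G J σ = eaEnergy G J τ →
      ∀ e : G.edgeSet, spinProduct σ (e : Sym2 V) = spinProduct τ (e : Sym2 V) := by
  rw [ae_all_iff]
  intro σ
  rw [ae_all_iff]
  intro τ
  by_cases hc : (fun e : G.edgeSet =>
      spinProduct σ (e : Sym2 V) - spinProduct τ (e : Sym2 V)) = 0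
  · exact Filter.Eventually.of_forall fun J _ e => sub_eq_zero.1 (congrFun hc e)
  · filter_upwards [gaussianPi_hyperplane_null hc] with J hJ h
    refine absurd ?_ hJ
    have h' : ∑ e : G.edgeSet, J e * spinProduct σ (e : Sym2 V) =
        ∑ e : G.edgeSet, J e * spinProduct τ (e : Sym2 V) := neg_injective h
    simp only [sub_mul, Finset.sum_sub_distrib]
    rw [sub_eq_zero]
    simpa only [mul_comm] using h'

theorem measurableSet_groundState_energy {V : Type*} [Finite V] (G : SimpleGraph V)
    [Fintype G.edgeSet] (S : Set (V → ℤˣ)) (r x : ℝ) :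
    MeasurableSet {ω : (G.edgeSet → ℝ) × (G.edgeSet → ℝ) |
      ∃ σ, IsGroundState G S ω.1 σ ∧ x ≤ r * eaEnergy G ω.2 σ} := by
  have h : {ω : (G.edgeSet → ℝ) × (G.edgeSet → ℝ) |
      ∃ σ, IsGroundState G S ω.1 σ ∧ x ≤ r * eaEnergy G ω.2 σ} =
      ⋃ σ : V → ℤˣ, (Prod.fst ⁻¹' {J | IsGroundState G S J σ}) ∩
        {ω | x ≤ r * eaEnergy G ω.2 σ} := by
    ext ω
    simp
  rw [h]
  refine MeasurableSet.iUnion fun σ =>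
    (measurable_fst (measurableSet_isGroundState G S σ)).inter ?_
  exact measurableSet_le measurable_const
    (((measurable_eaEnergy G σ).comp measurable_snd).const_mul r)

/-- The energy of a ground state in an independent environment has Gaussian tails. -/
theorem groundState_energy_tail {V : Type*} [Finite V] (G : SimpleGraph V) [Fintype G.edgeSet]
    (S : Set (V → ℤˣ)) {r N x : ℝ} (hr : |r| ≤ 1) (hN : (Fintype.card G.edgeSet : ℝ) ≤ N)
    (hN0 : 0 < N) (hx : 0 ≤ x) :
    (disorderLaw G.edgeSet).real {ω | ∃ σ, IsGroundState G S ω.1 σ ∧ x ≤ r * eaEnergy G ω.2 σ} ≤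
      Real.exp (-(x ^ 2 / (2 * N))) := by
  refine ENNReal.toReal_le_of_le_ofReal (Real.exp_pos _).le ?_
  rw [disorderLaw, Measure.prod_apply (measurableSet_groundState_energy G S r x)]
  calc _ ≤ ∫⁻ _J, ENNReal.ofReal (Real.exp (-(x ^ 2 / (2 * N)))) ∂(gaussianPi G.edgeSet) := by
        refine lintegral_mono_ae ?_
        -- For almost every fixed `J`, all ground states share the same spin products, so their
        -- energy in the second environment is one linear form with coefficients of modulus at most
        -- one.
        filter_upwards [ae_spinProduct_eq_of_eaEnergy_eq G] with J hJ
        by_cases hex : ∃ σ, IsGroundState G S J σ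
        · obtain ⟨σ₀, h₀⟩ := hex
          have hsub : Prod.mk J ⁻¹' {ω : (G.edgeSet → ℝ) × (G.edgeSet → ℝ) |
              ∃ σ, IsGroundState G S ω.1 σ ∧ x ≤ r * eaEnergy G ω.2 σ} ⊆
              {K | x ≤ ∑ e : G.edgeSet, (-r * spinProduct σ₀ (e : Sym2 V)) * K e} := by
            rintro K ⟨σ, hσ, hx⟩
            have heq := hJ σ σ₀ (le_antisymm (hσ.2 _ h₀.1) (h₀.2 _ hσ.1))
            refine hx.trans (le_of_eq ?_)
            simp only [eaEnergy, mul_neg, Finset.mul_sum, ← Finset.sum_neg_distrib]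
            refine Finset.sum_congr rfl fun e _ => ?_
            rw [heq e]
            ring
          refine (measure_mono hsub).trans ?_
          rw [← ofReal_measureReal]
          refine ENNReal.ofReal_le_ofReal (gaussianPi_linear_tail (fun e => ?_) hN hN0 hx)
          rw [abs_mul, abs_neg, abs_spinProduct, mul_one]
          exact hr
        · have hempty : Prod.mk J ⁻¹' {ω : (G.edgeSet → ℝ) × (G.edgeSet → ℝ) |
              ∃ σ, IsGroundState G S ω.1 σ ∧ x ≤ r * eaEnergy G ω.2 σ} = ∅ := by
            ext K
            simp only [Set.mem_preimage, Set.mem_ofPred_eq, Set.mem_empty_iff_false, iff_false]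
            exact fun ⟨σ, hσ, _⟩ => hex ⟨σ, hσ⟩
          rw [hempty]
          simp
    _ = _ := by simp

/-! ### The lower bound on the boundary and its exceptional events -/

/-- The deterministic part of the argument: outside of the exceptional events, the droplet has a
large boundary. -/
theorem le_ncard_edgeBoundary {V : Type*} [Finite V] (G : SimpleGraph V) [Fintype G.edgeSet]
    {J K L : G.edgeSet → ℝ} {σ τ : V → ℤˣ} {p a t x : ℝ} (hp : 0 < p) (hp1 : p < 1) (ht : 0 < t)
    (hx : 6 * √p * t * x ≤ p * a)
    (hL : L = (-√(2 * p - p ^ 2)) • J + (1 - p) • K)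
    (hσ : eaEnergy G J σ ≤ -a) (hτ : eaEnergy G (perturb p J K) τ ≤ -a)
    (hKσ : -(√(p / 8) * a) * 2 ≤ 2 * eaEnergy G K σ)
    (hLτ : eaEnergy G L τ ≤ √(p / 8) * a)
    (ha : 0 ≤ a) (hJ : ∀ e, |J e| ≤ t) (hK : ∀ e, |K e| ≤ t) :
    x ≤ ((edgeBoundary G (overturned σ τ)).ncard : ℝ) := by
  set s := √(2 * p - p ^ 2) with hs
  have hs2 : s ^ 2 = 2 * p - p ^ 2 := Real.sq_sqrt (by nlinarith)
  have hs0 : 0 ≤ s := Real.sqrt_nonneg _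
  have hq2 : √p ^ 2 = p := Real.sq_sqrt hp.le
  have hq0 : 0 < √p := Real.sqrt_pos.2 hp
  have hsq : s ≤ 2 * √p := by nlinarith
  -- Since `s² ≤ 2p`; this is why the fluctuation threshold is `√(p / 8) * a`.
  have hy : s * √(p / 8) ≤ p / 2 := by
    have h8 : √(p / 8) ^ 2 = p / 8 := Real.sq_sqrt (by positivity)
    refine abs_le_of_sq_le_sq' ?_ (by positivity) |>.2
    rw [mul_pow, hs2, h8]
    nlinarith [pow_pos hp 3]
  have hpq : p ≤ √p := by
    nlinarith [Real.sqrt_le_one.2 hp1.le]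
  have hb : ∀ e, |J e - perturb p J K e| ≤ 3 * √p * t := by
    intro e
    have h1 : J e - perturb p J K e = p * J e - s * K e := by
      simp only [perturb, ← hs]
      ring
    rw [h1]
    refine (abs_sub _ _).trans ?_
    rw [abs_mul, abs_mul, abs_of_pos hp, abs_of_nonneg hs0]
    calc p * |J e| + s * |K e| ≤ √p * t + 2 * √p * t := by
          gcongr
          · exact hJ e
          · exact hK e
      _ = _ := by ring
  have hD := energy_difference_le G J (perturb p J K) σ τ hb
  have h1 : eaEnergy G (perturb p J K) σ = (1 - p) * eaEnergy G J σ + s * eaEnergy G K σ :=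
    eaEnergy_perturb G J K (1 - p) s σ
  -- The inverse rotation recovers `J` from its perturbation and `L`.
  have hJ' : J = fun e => (1 - p) * perturb p J K e + (-s) * L e := by
    ext e
    simp only [hL, perturb, ← hs, Pi.add_apply, Pi.smul_apply, smul_eq_mul]
    linear_combination (-J e) * hs2
  have h2 : eaEnergy G J τ = (1 - p) * eaEnergy G (perturb p J K) τ + (-s) * eaEnergy G L τ := by
    conv_lhs => rw [hJ']
    exact eaEnergy_perturb G _ _ (1 - p) (-s) τ
  have h3 : s * eaEnergy G K σ ≥ -(p / 2 * a) := by
    have : s * (√(p / 8) * a) ≤ p / 2 * a := by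
      rw [← mul_assoc]
      gcongr
    have : s * -(√(p / 8) * a) ≤ s * eaEnergy G K σ := by
      gcongr
      linarith
    linarith
  have h4 : s * eaEnergy G L τ ≤ p / 2 * a := by
    calc s * eaEnergy G L τ ≤ s * (√(p / 8) * a) := by gcongr
      _ = s * √(p / 8) * a := by ring
      _ ≤ _ := by gcongr
  have h5 : p * eaEnergy G J σ ≤ p * -a := by gcongr
  have h6 : p * eaEnergy G (perturb p J K) τ ≤ p * -a := by gcongr
  -- The two ground state energies give `2 * p * a`, the two fluctuation terms lose at most `p * a /
  -- 2` each.
  have h7 : p * a ≤ 6 * √p * t * ((edgeBoundary G (overturned σ τ)).ncard : ℝ) := by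
    linarith
  exact le_of_mul_le_mul_left (hx.trans h7) (by positivity)

/-- A union bound over eight exceptional events: too small a sum over the matching, too large a
contribution of the edges inside `B`, and too large a fluctuation, each for the environment before
and after the rotation; and a too large coupling in `J` or in `J'`. -/
theorem le_dropletProb {V : Type} [Fintype V] [DecidableEq V] (G : SimpleGraph V)
    [Fintype G.edgeSet] (B : Set V) (γ : V → ℤˣ) (r : V → V)
    (hr : ∀ i, r (r i) = r i) (hfib : ∀ i j, r i = r j → i = j ∨ j = r i ∨ i = r j)
    (M : Finset G.edgeSet)
    (hM : ∀ e : G.edgeSet, e ∈ M ↔ ∃ i, i ∉ B ∧ r i ∉ B ∧ (e : Sym2 V) = s(i, r i))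
    {S : Set (V → ℤˣ)} (hS : ∀ σ, σ ∈ S ↔ ∀ i ∈ B, σ i = γ i) {c N p a t x : ℝ} (hc0 : 0 < c)
    (hc : (gaussianPi G.edgeSet).real {J | ∑ e ∈ M, |J e| ≤ c * M.card} ≤
      Real.exp (-(c * M.card)))
    (hN : (Fintype.card G.edgeSet : ℝ) ≤ N) (hN0 : 0 < N) (hp : 0 < p) (hp1 : p < 1)
    (ha : a = c * M.card / 2) (ht : 0 < t) (hx : 6 * √p * t * x ≤ p * a) :
    1 - (2 * Real.exp (-(p * a ^ 2 / (16 * N))) + 2 * Real.exp (-(2 * a)) +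
      2 * Real.exp (-(a ^ 2 / (2 * N))) + 4 * N * Real.exp (-(t ^ 2 / 2))) ≤
      dropletProb G S p x := by
  classical
  set Φ : (G.edgeSet → ℝ) × (G.edgeSet → ℝ) → (G.edgeSet → ℝ) × (G.edgeSet → ℝ) := fun ω =>
    (perturb p ω.1 ω.2, (-√(2 * p - p ^ 2)) • ω.1 + (1 - p) • ω.2) with hΦ
  have hΦm : MeasurePreserving Φ (disorderLaw G.edgeSet) (disorderLaw G.edgeSet) :=
    measurePreserving_perturb hp hp1
  have hfst : MeasurePreserving Prod.fst (disorderLaw G.edgeSet) (gaussianPi G.edgeSet) :=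
    measurePreserving_fst
  have hsnd : MeasurePreserving Prod.snd (disorderLaw G.edgeSet) (gaussianPi G.edgeSet) :=
    measurePreserving_snd
  have ha0 : 0 ≤ a := by rw [ha]; positivity
  set w : G.edgeSet → ℝ := fun e =>
    if ∀ v ∈ (e : Sym2 V), v ∈ B then spinProduct γ (e : Sym2 V) else 0 with hw
  set y := √(p / 8) * a with hy
  have hy0 : 0 ≤ y := by positivity
  set F₁ : Set (G.edgeSet → ℝ) := {J | ∑ e ∈ M, |J e| ≤ c * M.card} with hF₁
  set F₂ : Set (G.edgeSet → ℝ) := {J | a ≤ ∑ e, (-w e) * J e} with hF₂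
  set F₃ : Set (G.edgeSet → ℝ) := {J | ∃ e, t ≤ |J e|} with hF₃
  set A : ℝ → Set ((G.edgeSet → ℝ) × (G.edgeSet → ℝ)) := fun q =>
    {ω | ∃ σ, IsGroundState G S ω.1 σ ∧ y ≤ q * eaEnergy G ω.2 σ} with hA
  have hF₁m : MeasurableSet F₁ :=
    (isClosed_le (by fun_prop) (by fun_prop)).measurableSet
  have hF₂m : MeasurableSet F₂ :=
    (isClosed_le (by fun_prop) (by fun_prop)).measurableSet
  have hF₃m : MeasurableSet F₃ := by
    have : F₃ = ⋃ e, {J | t ≤ |J e|} := by ext; simp [hF₃]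
    rw [this]
    exact MeasurableSet.iUnion fun e => (isClosed_le (by fun_prop) (by fun_prop)).measurableSet
  have hF₁b : (gaussianPi G.edgeSet).real F₁ ≤ Real.exp (-(2 * a)) := by
    rw [ha, mul_div_cancel₀ _ two_ne_zero]
    exact hc
  have hF₂b : (gaussianPi G.edgeSet).real F₂ ≤ Real.exp (-(a ^ 2 / (2 * N))) := by
    refine gaussianPi_linear_tail (fun e => ?_) hN hN0 ha0
    rw [abs_neg]
    by_cases h : ∀ v ∈ (e : Sym2 V), v ∈ B
    · simp only [hw, if_pos h, abs_spinProduct, le_refl]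
    · simp only [hw, if_neg h, abs_zero, zero_le_one]
  have hF₃b : (gaussianPi G.edgeSet).real F₃ ≤ N * (2 * Real.exp (-(t ^ 2 / 2))) :=
    gaussianPi_sup_tail hN ht.le
  have hAb : ∀ q : ℝ, |q| ≤ 1 → (disorderLaw G.edgeSet).real (A q) ≤
      Real.exp (-(p * a ^ 2 / (16 * N))) := by
    intro q hq
    have h := groundState_energy_tail G S hq hN hN0 hy0
    have h8 : y ^ 2 / (2 * N) = p * a ^ 2 / (16 * N) := by
      rw [hy, mul_pow, Real.sq_sqrt (by positivity)]
      field_simp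
      ring
    rwa [h8] at h
  -- Off `F₁` the matching gains more than `2 * a`; off `F₂` the edges inside `B` cost less than
  -- `a`.
  have hlow : ∀ J σ, J ∉ F₁ → J ∉ F₂ → IsGroundState G S J σ → eaEnergy G J σ ≤ -a := by
    intro J σ h₁ h₂ hσ
    obtain ⟨τ, hτ, hle⟩ := exists_energy_le_matching G B γ r hr hfib M hM J
    have h3 := hσ.2 τ ((hS τ).2 hτ)
    simp only [hF₁, hF₂, Set.mem_ofPred_eq, not_le, neg_mul, Finset.sum_neg_distrib] at h₁ h₂
    simp only [hw] at h₂
    linarith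
  set Z : Set ((G.edgeSet → ℝ) × (G.edgeSet → ℝ)) := {ω |
    ∀ σ τ : V → ℤˣ, IsGroundState G S ω.1 σ →
    IsGroundState G S (perturb p ω.1 ω.2) τ →
      x ≤ ((edgeBoundary G (overturned σ τ)).ncard : ℝ)} with hZ
  have hcover : (Set.univ : Set ((G.edgeSet → ℝ) × (G.edgeSet → ℝ))) ⊆
      Z ∪ (Prod.fst ⁻¹' F₁ ∪ (Prod.fst ⁻¹' F₂ ∪ (Prod.fst ⁻¹' F₃ ∪ (Prod.snd ⁻¹' F₃ ∪
        (A (-1) ∪ (Φ ⁻¹' (Prod.fst ⁻¹' F₁) ∪ (Φ ⁻¹' (Prod.fst ⁻¹' F₂) ∪ Φ ⁻¹' A 1))))))) := by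
    intro ω _
    by_contra hn
    simp only [Set.mem_union, not_or] at hn
    obtain ⟨hz, h1, h2, h3, h4, h5, h6, h7, h8⟩ := hn
    refine hz fun σ τ hσ hτ => ?_
    refine le_ncard_edgeBoundary G hp hp1 ht hx rfl (hlow _ _ h1 h2 hσ) (hlow _ _ h6 h7 hτ)
      ?_ ?_ ha0 ?_ ?_
    · by_contra hlt
      refine h5 ⟨σ, hσ, ?_⟩
      rw [← hy] at hlt
      linarith
    · by_contra hlt
      refine h8 ⟨τ, hτ, ?_⟩
      rw [one_mul]
      exact (not_le.1 hlt).le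
    · exact fun e => le_of_not_ge fun h => h3 ⟨e, h⟩
    · exact fun e => le_of_not_ge fun h => h4 ⟨e, h⟩
  have hpre : ∀ F : Set (G.edgeSet → ℝ), MeasurableSet F →
      (disorderLaw G.edgeSet).real (Prod.fst ⁻¹' F) = (gaussianPi G.edgeSet).real F := fun F hF =>
    hfst.measureReal_preimage hF.nullMeasurableSet
  have hpreΦ : ∀ F : Set ((G.edgeSet → ℝ) × (G.edgeSet → ℝ)), MeasurableSet F →
      (disorderLaw G.edgeSet).real (Φ ⁻¹' F) = (disorderLaw G.edgeSet).real F := fun F hF =>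
    hΦm.measureReal_preimage hF.nullMeasurableSet
  have htot : (1 : ℝ) ≤ (disorderLaw G.edgeSet).real Z + ((gaussianPi G.edgeSet).real F₁ +
      ((gaussianPi G.edgeSet).real F₂ + ((gaussianPi G.edgeSet).real F₃ +
      ((gaussianPi G.edgeSet).real F₃ + ((disorderLaw G.edgeSet).real (A (-1)) +
      ((gaussianPi G.edgeSet).real F₁ + ((gaussianPi G.edgeSet).real F₂ +
        (disorderLaw G.edgeSet).real (A 1)))))))) := by
    have hone : (disorderLaw G.edgeSet).real Set.univ = 1 := probReal_univ
    refine hone.ge.trans ((measureReal_mono hcover).trans ?_)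
    refine (measureReal_union_le _ _).trans (add_le_add le_rfl ?_)
    refine (measureReal_union_le _ _).trans (add_le_add (hpre F₁ hF₁m).le ?_)
    refine (measureReal_union_le _ _).trans (add_le_add (hpre F₂ hF₂m).le ?_)
    refine (measureReal_union_le _ _).trans (add_le_add (hpre F₃ hF₃m).le ?_)
    refine (measureReal_union_le _ _).trans
      (add_le_add (hsnd.measureReal_preimage hF₃m.nullMeasurableSet).le ?_)
    refine (measureReal_union_le _ _).trans (add_le_add le_rfl ?_)
    refine (measureReal_union_le _ _).trans
      (add_le_add ((hpreΦ _ (measurable_fst hF₁m)).trans (hpre F₁ hF₁m)).le ?_)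
    refine (measureReal_union_le _ _).trans
      (add_le_add ((hpreΦ _ (measurable_fst hF₂m)).trans (hpre F₂ hF₂m)).le ?_)
    exact (hpreΦ _ (measurableSet_groundState_energy G S 1 y)).le
  have hz : dropletProb G S p x = (disorderLaw G.edgeSet).real Z := rfl
  have hA1 := hAb 1 (by simp)
  have hA2 := hAb (-1) (by simp)
  rw [hz]
  linarith

/-! ### Matchings and edge counts in lattice boxes -/

/-- Each vertex whose `k`-th coordinate is even and positive is paired with its predecessor in
direction `k`. -/
def pairRoot {d n : ℕ} (k : Fin d) (x : Fin d → Fin n) : Fin d → Fin n :=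
  if (x k : ℕ) % 2 = 0 ∧ 0 < (x k : ℕ) then
    Function.update x k ⟨(x k : ℕ) - 1, (Nat.sub_le _ _).trans_lt (x k).2⟩
  else x

theorem pairRoot_of_ne {d n : ℕ} {k j : Fin d} (hj : j ≠ k) (x : Fin d → Fin n) :
    pairRoot k x j = x j := by
  unfold pairRoot
  split_ifs
  · exact Function.update_of_ne hj _ _
  · rfl

theorem pairRoot_same {d n : ℕ} (k : Fin d) (x : Fin d → Fin n) :
    ((pairRoot k x k : Fin n) : ℕ) =
      if (x k : ℕ) % 2 = 0 ∧ 0 < (x k : ℕ) then (x k : ℕ) - 1 else x k := by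
  unfold pairRoot
  split_ifs <;> simp

theorem eq_of_coordinate_eq {d n : ℕ} {k : Fin d} {x y : Fin d → Fin n}
    (h : ∀ j, j ≠ k → x j = y j) (hk : (x k : ℕ) = y k) : x = y := by
  ext j
  by_cases hj : j = k
  · rw [hj, hk]
  · rw [h j hj]

theorem pairRoot_idem {d n : ℕ} (k : Fin d) (x : Fin d → Fin n) :
    pairRoot k (pairRoot k x) = pairRoot k x := by
  refine eq_of_coordinate_eq (k := k) (fun j hj => pairRoot_of_ne hj _) ?_
  rw [pairRoot_same k (pairRoot k x), pairRoot_same]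
  split_ifs <;> omega

theorem pairRoot_fiber {d n : ℕ} (k : Fin d) (x y : Fin d → Fin n)
    (h : pairRoot k x = pairRoot k y) : x = y ∨ y = pairRoot k x ∨ x = pairRoot k y := by
  have hne : ∀ j, j ≠ k → x j = y j := fun j hj => by
    rw [← pairRoot_of_ne hj x, h, pairRoot_of_ne hj]
  have hk : ((pairRoot k x k : Fin n) : ℕ) = pairRoot k y k := by rw [h]
  rw [pairRoot_same, pairRoot_same] at hk
  by_cases hxy : (x k : ℕ) = y k
  · exact Or.inl (eq_of_coordinate_eq hne hxy)
  by_cases hx : (x k : ℕ) % 2 = 0 ∧ 0 < (x k : ℕ)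
  · refine Or.inr (Or.inl (eq_of_coordinate_eq (k := k)
      (fun j hj => by rw [pairRoot_of_ne hj, hne j hj]) ?_))
    rw [pairRoot_same, if_pos hx]
    rw [if_pos hx] at hk
    split_ifs at hk with hy <;> omega
  · refine Or.inr (Or.inr (eq_of_coordinate_eq (k := k)
      (fun j hj => by rw [pairRoot_of_ne hj, hne j hj]) ?_))
    rw [pairRoot_same]
    rw [if_neg hx] at hk
    exact hk

/-- The edges of a lattice box, possibly with periodic boundary, are indexed by a direction and a
starting point. -/
theorem card_edgeSet_le {d n : ℕ} (G : SimpleGraph (Fin d → Fin n)) [Fintype G.edgeSet]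
    (hG : ∀ x y, G.Adj x y → (∃ k, (y k : ℕ) = ((x k : ℕ) + 1) % n ∧ ∀ j, j ≠ k → y j = x j) ∨
      ∃ k, (x k : ℕ) = ((y k : ℕ) + 1) % n ∧ ∀ j, j ≠ k → x j = y j) :
    Fintype.card G.edgeSet ≤ d * n ^ d := by
  have hex : ∀ e : G.edgeSet, ∃ q : Fin d × (Fin d → Fin n), ∃ y : Fin d → Fin n,
      (e : Sym2 _) = s(q.2, y) ∧ (y q.1 : ℕ) = ((q.2 q.1 : ℕ) + 1) % n ∧
        ∀ j, j ≠ q.1 → y j = q.2 j := by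
    rintro ⟨e, he⟩
    induction e with
    | _ x y =>
      rcases hG x y he with ⟨k, h1, h2⟩ | ⟨k, h1, h2⟩
      · exact ⟨(k, x), y, rfl, h1, h2⟩
      · exact ⟨(k, y), x, Sym2.eq_swap, h1, h2⟩
  choose q y hq hk hj using hex
  -- Direction and starting point determine the other endpoint, hence the edge.
  have hinj : Function.Injective q := by
    intro e e' h
    have hy : y e = y e' := eq_of_coordinate_eq (k := (q e).1)
      (fun j hj' => by rw [hj e j hj', hj e' j (h ▸ hj'), h]) (by
        rw [hk e, h, hk e'])
    exact Subtype.ext (by rw [hq e, hq e', h, hy])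
  refine (Fintype.card_le_of_injective q hinj).trans (le_of_eq ?_)
  simp

/-- A lattice box contains many disjoint edges away from its boundary. -/
theorem le_card_matching {d L n : ℕ} (k : Fin d) (hn : L ≤ n) (G : SimpleGraph (Fin d → Fin n))
    (hG : ∀ x y : Fin d → Fin n, (y k : ℕ) = (x k : ℕ) + 1 → (∀ j, j ≠ k → y j = x j) →
      G.Adj x y) (B : Set (Fin d → Fin n))
    (hB : ∀ x ∈ B, ∃ j, (x j : ℕ) = 0 ∨ (x j : ℕ) = L) (M : Finset G.edgeSet)
    (hM : ∀ e : G.edgeSet, e ∈ M ↔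
      ∃ i, i ∉ B ∧ pairRoot k i ∉ B ∧ (e : Sym2 (Fin d → Fin n)) = s(i, pairRoot k i)) :
    ((L - 1) / 2) ^ d ≤ M.card := by
  classical
  set m := (L - 1) / 2 with hm
  -- Upper endpoints of matched edges. The `k`-th coordinates of the pair are `2z + 2` and `2z + 1`,
  -- and all coordinates lie between `1` and `L - 1` because `2m ≤ L - 1`.
  set f : (Fin d → Fin m) → Fin d → Fin n := fun z j =>
    ⟨if j = k then 2 * (z j : ℕ) + 2 else (z j : ℕ) + 1, by
      have := (z j).2
      split_ifs <;> omega⟩ with hf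
  have hfk : ∀ z, (f z k : ℕ) = 2 * (z k : ℕ) + 2 := fun z => by simp [hf]
  have hfj : ∀ z j, j ≠ k → (f z j : ℕ) = (z j : ℕ) + 1 := fun z j hj => by simp [hf, hj]
  have hrk : ∀ z, (pairRoot k (f z) k : ℕ) = 2 * (z k : ℕ) + 1 := fun z => by
    rw [pairRoot_same, hfk, if_pos (by omega)]
    omega
  have hfB : ∀ z, f z ∉ B := by
    intro z hz
    obtain ⟨j, hj⟩ := hB _ hz
    have := (z j).2
    by_cases hjk : j = k
    · subst hjk
      rw [hfk] at hj
      omega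
    · rw [hfj z j hjk] at hj
      omega
  have hrB : ∀ z, pairRoot k (f z) ∉ B := by
    intro z hz
    obtain ⟨j, hj⟩ := hB _ hz
    have := (z j).2
    by_cases hjk : j = k
    · subst hjk
      rw [hrk] at hj
      omega
    · rw [pairRoot_of_ne hjk, hfj z j hjk] at hj
      omega
  have hadj : ∀ z, s(f z, pairRoot k (f z)) ∈ G.edgeSet := fun z =>
    (hG _ _ (by rw [hrk, hfk]) fun j hj => (pairRoot_of_ne hj _).symm).symm
  have hcard : Fintype.card (Fin d → Fin m) = m ^ d := by simp
  rw [← hcard, ← Finset.card_univ]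
  refine Finset.card_le_card_of_injOn (fun z => ⟨s(f z, pairRoot k (f z)), hadj z⟩)
    (fun z _ => (hM _).2 ⟨f z, hfB z, hrB z, rfl⟩) ?_
  intro z _ w _ hzw
  rcases Sym2.eq_iff.1 (Subtype.ext_iff.1 hzw) with ⟨h, _⟩ | ⟨h, _⟩
  · funext j
    have hj : (f z j : ℕ) = f w j := by rw [h]
    apply Fin.ext
    by_cases hjk : j = k
    · subst hjk
      rw [hfk, hfk] at hj
      omega
    · rw [hfj z j hjk, hfj w j hjk] at hj
      omega
  -- Upper endpoints have even `k`-th coordinate and lower ones odd, so they never coincide.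
  · have hk : (f z k : ℕ) = pairRoot k (f w) k := by rw [h]
    rw [hfk, hrk] at hk
    omega

/-! ### Explicit constants and the three boundary conditions -/

theorem exp_neg_le_inv {x y : ℝ} (hy : 0 < y) (h : y ≤ x) : Real.exp (-x) ≤ 1 / y := by
  rw [Real.exp_neg, ← one_div]
  exact one_div_le_one_div_of_le hy (h.trans (by linarith [Real.add_one_le_exp x]))

/-- The droplet estimate on a lattice box of side at least three, with explicit constants. -/
theorem le_dropletProb_lattice {d L n : ℕ} (k : Fin d) (hL : 3 ≤ L) (hn : L ≤ n) (hn' : n ≤ L + 1)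
    (G : SimpleGraph (Fin d → Fin n)) [Fintype G.edgeSet]
    (hG : ∀ x y : Fin d → Fin n, (y k : ℕ) = (x k : ℕ) + 1 → (∀ j, j ≠ k → y j = x j) →
      G.Adj x y)
    (hG' : ∀ x y, G.Adj x y → (∃ k, (y k : ℕ) = ((x k : ℕ) + 1) % n ∧ ∀ j, j ≠ k → y j = x j) ∨
      ∃ k, (x k : ℕ) = ((y k : ℕ) + 1) % n ∧ ∀ j, j ≠ k → x j = y j)
    (B : Set (Fin d → Fin n)) (hB : ∀ x ∈ B, ∃ j, (x j : ℕ) = 0 ∨ (x j : ℕ) = L)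
    (γ : (Fin d → Fin n) → ℤˣ) {S : Set ((Fin d → Fin n) → ℤˣ)}
    (hS : ∀ σ, σ ∈ S ↔ ∀ i ∈ B, σ i = γ i) {c p x : ℝ} (hc0 : 0 < c)
    (hc : ∀ (E : Type) [Fintype E] (M : Finset E),
      (gaussianPi E).real {J | ∑ e ∈ M, |J e| ≤ c * M.card} ≤ Real.exp (-(c * M.card)))
    (hp : 0 < p) (hp1 : p < 1) {b D : ℝ} (hb : b = c / 2 / 6 ^ d) (hD : D = d * 2 ^ d)
    (hx : x ≤ b / (6 * √(2 * (d + 1))) * √p * (L : ℝ) ^ d * (Real.log L) ^ (-(1 / 2) : ℝ)) :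
    1 - 2 * Real.exp (-(b ^ 2 / (16 * D) * p * (L : ℝ) ^ d)) -
      (1 / b + 4 * D / b ^ 2 + 4 * D) / L ≤ dropletProb G S p x := by
  classical
  have hd : 0 < d := k.pos
  have hL0 : (0 : ℝ) < L := by positivity
  have hL1 : (1 : ℝ) ≤ L := by exact_mod_cast (by omega : 1 ≤ L)
  have hlog : 0 < Real.log L := Real.log_pos (by exact_mod_cast (by omega : 1 < L))
  have hb0 : 0 < b := by rw [hb]; positivity
  have hD0 : 0 < D := by rw [hD]; positivity
  have hLd : (L : ℝ) ≤ (L : ℝ) ^ d := le_self_pow₀ hL1 hd.ne'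
  set M : Finset G.edgeSet := Finset.univ.filter fun e =>
    ∃ i, i ∉ B ∧ pairRoot k i ∉ B ∧ (e : Sym2 (Fin d → Fin n)) = s(i, pairRoot k i) with hMdef
  have hM : ∀ e : G.edgeSet, e ∈ M ↔ ∃ i, i ∉ B ∧ pairRoot k i ∉ B ∧
      (e : Sym2 (Fin d → Fin n)) = s(i, pairRoot k i) := fun e => by simp [hMdef]
  set a : ℝ := c * M.card / 2 with ha
  have hcard := le_card_matching k hn G hG B hB M hM
  have hMc : ((L : ℝ) / 6) ^ d ≤ M.card := by
    have h1 : (L : ℝ) / 6 ≤ (((L - 1) / 2 : ℕ) : ℝ) := by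
      rw [div_le_iff₀ (by norm_num)]
      exact_mod_cast (by omega : L ≤ (L - 1) / 2 * 6)
    calc ((L : ℝ) / 6) ^ d ≤ (((L - 1) / 2 : ℕ) : ℝ) ^ d := by gcongr
      _ ≤ M.card := by exact_mod_cast hcard
  have hab : b * (L : ℝ) ^ d ≤ a := by
    have : b * (L : ℝ) ^ d = c * ((L : ℝ) / 6) ^ d / 2 := by
      rw [hb, div_pow]
      field_simp
    rw [this, ha]
    gcongr
  have hN : (Fintype.card G.edgeSet : ℝ) ≤ D * (L : ℝ) ^ d := by
    have h1 : Fintype.card G.edgeSet ≤ d * (2 * L) ^ d :=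
      (card_edgeSet_le G hG').trans (by gcongr; omega)
    have h2 : (Fintype.card G.edgeSet : ℝ) ≤ d * (2 * L) ^ d := by exact_mod_cast h1
    rwa [mul_pow, ← mul_assoc, ← hD] at h2
  -- Chosen so that `exp(-t²/2) = L^(-(d+1))`, which beats the number of edges, of order `L^d`, by a
  -- factor `L`.
  set t := √(2 * (d + 1)) * √(Real.log L) with ht
  have ht0 : 0 < t := by positivity
  have hxa : 6 * √p * t * x ≤ p * a := by
    have hlogpow : √(Real.log L) * (Real.log L) ^ (-(1 / 2) : ℝ) = 1 := by
      rw [Real.sqrt_eq_rpow, ← Real.rpow_add hlog]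
      norm_num
    calc 6 * √p * t * x ≤ 6 * √p * t *
          (b / (6 * √(2 * (d + 1))) * √p * (L : ℝ) ^ d * (Real.log L) ^ (-(1 / 2) : ℝ)) := by
          gcongr
      _ = (√p * √p) * (b * (L : ℝ) ^ d) *
          (√(Real.log L) * (Real.log L) ^ (-(1 / 2) : ℝ)) := by
          rw [ht]
          have : √(2 * ((d : ℝ) + 1)) ≠ 0 := by positivity
          field_simp
      _ = p * (b * (L : ℝ) ^ d) := by rw [Real.mul_self_sqrt hp.le, hlogpow, mul_one]
      _ ≤ p * a := by gcongr
  have hmain := le_dropletProb G B γ (pairRoot k) (pairRoot_idem k) (pairRoot_fiber k) M hM hS hc0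
    (hc _ M) hN (by positivity) hp hp1 ha ht0 hxa
  have hq : (b * (L : ℝ) ^ d) ^ 2 ≤ a ^ 2 := by gcongr
  have e1 : Real.exp (-(p * a ^ 2 / (16 * (D * (L : ℝ) ^ d)))) ≤
      Real.exp (-(b ^ 2 / (16 * D) * p * (L : ℝ) ^ d)) := by
    apply Real.exp_le_exp.2
    rw [neg_le_neg_iff]
    calc b ^ 2 / (16 * D) * p * (L : ℝ) ^ d =
          p * (b * (L : ℝ) ^ d) ^ 2 / (16 * (D * (L : ℝ) ^ d)) := by field_simp
      _ ≤ _ := by gcongr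
  have e2 : Real.exp (-(2 * a)) ≤ 1 / (2 * (b * L)) := by
    refine exp_neg_le_inv (by positivity) ?_
    have : b * L ≤ b * (L : ℝ) ^ d := by gcongr
    linarith
  have e3 : Real.exp (-(a ^ 2 / (2 * (D * (L : ℝ) ^ d)))) ≤ 1 / (b ^ 2 * L / (2 * D)) := by
    refine exp_neg_le_inv (by positivity) ?_
    calc b ^ 2 * L / (2 * D) ≤ b ^ 2 * (L : ℝ) ^ d / (2 * D) := by gcongr
      _ = (b * (L : ℝ) ^ d) ^ 2 / (2 * (D * (L : ℝ) ^ d)) := by field_simp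
      _ ≤ _ := by gcongr
  have e4 : Real.exp (-(t ^ 2 / 2)) = 1 / (L : ℝ) ^ (d + 1) := by
    have : t ^ 2 / 2 = ((d + 1 : ℕ) : ℝ) * Real.log L := by
      rw [ht, mul_pow, Real.sq_sqrt (by positivity), Real.sq_sqrt hlog.le]
      push_cast
      ring
    rw [this, Real.exp_neg, Real.exp_nat_mul, Real.exp_log hL0, one_div]
  have e5 : 2 * (1 / (2 * (b * L))) + 2 * (1 / (b ^ 2 * L / (2 * D))) +
      4 * (D * (L : ℝ) ^ d) * (1 / (L : ℝ) ^ (d + 1)) = (1 / b + 4 * D / b ^ 2 + 4 * D) / L := by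
    rw [pow_succ]
    field_simp
    ring
  rw [e4] at hmain
  linarith

theorem cubeDropletProb_nonneg {d L : ℕ} (bc : CubeBC d L) (p x : ℝ) :
    0 ≤ cubeDropletProb bc p x := by
  cases bc <;> exact measureReal_nonneg

theorem cubeGraph_adj_of_succ {d L : ℕ} {k : Fin d} {x y : Fin d → Fin (L + 1)}
    (hk : (y k : ℕ) = (x k : ℕ) + 1) (hj : ∀ j, j ≠ k → y j = x j) : (cubeGraph d L).Adj x y := by
  rw [cubeGraph, SimpleGraph.fromRel_adj]
  refine ⟨fun h => ?_, Or.inl ⟨k, hk, hj⟩⟩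
  rw [h] at hk
  omega

theorem cubeGraph_adj {d L : ℕ} {x y : Fin d → Fin (L + 1)} (h : (cubeGraph d L).Adj x y) :
    (∃ k, (y k : ℕ) = ((x k : ℕ) + 1) % (L + 1) ∧ ∀ j, j ≠ k → y j = x j) ∨
      ∃ k, (x k : ℕ) = ((y k : ℕ) + 1) % (L + 1) ∧ ∀ j, j ≠ k → x j = y j := by
  rw [cubeGraph, SimpleGraph.fromRel_adj] at h
  rcases h.2 with ⟨k, hk, hj⟩ | ⟨k, hk, hj⟩
  · exact Or.inl ⟨k, by rw [← hk, Nat.mod_eq_of_lt (y k).2], hj⟩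
  · exact Or.inr ⟨k, by rw [← hk, Nat.mod_eq_of_lt (x k).2], hj⟩

theorem torusGraph_adj_of_succ {d L : ℕ} {k : Fin d} {x y : Fin d → Fin L}
    (hk : (y k : ℕ) = (x k : ℕ) + 1) (hj : ∀ j, j ≠ k → y j = x j) : (torusGraph d L).Adj x y := by
  rw [torusGraph, SimpleGraph.fromRel_adj]
  refine ⟨fun h => ?_, Or.inl ⟨k, ?_, hj⟩⟩
  · rw [h] at hk
    omega
  · rw [← hk, Nat.mod_eq_of_lt (y k).2]

theorem torusGraph_adj {d L : ℕ} {x y : Fin d → Fin L} (h : (torusGraph d L).Adj x y) :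
    (∃ k, (y k : ℕ) = ((x k : ℕ) + 1) % L ∧ ∀ j, j ≠ k → y j = x j) ∨
      ∃ k, (x k : ℕ) = ((y k : ℕ) + 1) % L ∧ ∀ j, j ≠ k → x j = y j := by
  rw [torusGraph, SimpleGraph.fromRel_adj] at h
  exact h.2

/-- The droplet estimate for all the boundary conditions. -/
theorem exists_le_cubeDropletProb (d : ℕ) (hd : 1 ≤ d) :
    ∃ C₁ C₂ C₃ : ℝ, 0 < C₁ ∧ 0 < C₂ ∧ 0 < C₃ ∧
      ∀ L : ℕ, 2 ≤ L → ∀ bc : CubeBC d L, ∀ p : ℝ, 0 < p → p < 1 → ∀ x : ℝ,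
        x ≤ C₁ * √p * (L : ℝ) ^ d * (Real.log L) ^ (-(1 / 2) : ℝ) →
        1 - 2 * Real.exp (-(C₂ * p * (L : ℝ) ^ d)) - C₃ / L ≤ cubeDropletProb bc p x := by
  classical
  obtain ⟨c, hc0, hc⟩ := exists_gaussianPi_abs_sum_tail
  obtain ⟨b, hb⟩ : ∃ b : ℝ, b = c / 2 / 6 ^ d := ⟨_, rfl⟩
  obtain ⟨D, hD⟩ : ∃ D : ℝ, D = d * 2 ^ d := ⟨_, rfl⟩
  have hb0 : 0 < b := by rw [hb]; positivity
  have hD0 : 0 < D := by rw [hD]; positivity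
  refine ⟨b / (6 * √(2 * (d + 1))), b ^ 2 / (16 * D), 2 + (1 / b + 4 * D / b ^ 2 + 4 * D),
    by positivity, by positivity, by positivity, ?_⟩
  intro L hL bc p hp hp1 x hx
  -- For `L = 2` the matching off the boundary may be empty; the summand `2` in `C₃` makes the bound
  -- trivial there.
  rcases hL.eq_or_lt with rfl | hL3
  · refine le_trans ?_ (cubeDropletProb_nonneg bc p x)
    have h1 : 0 ≤ 1 / b + 4 * D / b ^ 2 + 4 * D := by positivity
    have h2 := Real.exp_pos (-(b ^ 2 / (16 * D) * p * ((2 : ℕ) : ℝ) ^ d))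
    push_cast at h2 ⊢
    linarith
  have hk : 0 < d := hd
  have hweak : 1 - 2 * Real.exp (-(b ^ 2 / (16 * D) * p * (L : ℝ) ^ d)) -
      (2 + (1 / b + 4 * D / b ^ 2 + 4 * D)) / L ≤
      1 - 2 * Real.exp (-(b ^ 2 / (16 * D) * p * (L : ℝ) ^ d)) -
      (1 / b + 4 * D / b ^ 2 + 4 * D) / L := by
    have : 1 / b + 4 * D / b ^ 2 + 4 * D ≤ 2 + (1 / b + 4 * D / b ^ 2 + 4 * D) := by linarith
    gcongr
  refine hweak.trans ?_
  cases bc with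
  | fixed γ =>
    refine le_dropletProb_lattice ⟨0, hk⟩ hL3 (Nat.le_succ L) le_rfl (cubeGraph d L)
      (fun x y => cubeGraph_adj_of_succ) (fun x y => cubeGraph_adj) (cubeBoundary d L)
      (fun x hx => hx) (fun i => if h : i ∈ cubeBoundary d L then γ ⟨i, h⟩ else 1) ?_
      hc0 hc hp hp1 hb hD hx
    intro σ
    constructor
    · intro hσ i hi
      rw [dif_pos hi]
      exact hσ ⟨i, hi⟩
    · rintro hσ ⟨i, hi⟩
      rw [hσ i hi, dif_pos hi]
  | free =>
    exact le_dropletProb_lattice ⟨0, hk⟩ hL3 (Nat.le_succ L) le_rfl (cubeGraph d L)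
      (fun x y => cubeGraph_adj_of_succ) (fun x y => cubeGraph_adj) ∅
      (fun x hx => hx.elim) 1 (fun σ => by simp) hc0 hc hp hp1 hb hD hx
  | periodic =>
    exact le_dropletProb_lattice ⟨0, hk⟩ hL3 le_rfl (Nat.le_succ L) (torusGraph d L)
      (fun x y => torusGraph_adj_of_succ) (fun x y => torusGraph_adj) ∅
      (fun x hx => hx.elim) 1 (fun σ => by simp) hc0 hc hp hp1 hb hD hx

theorem mainTheorem4 (d : ℕ) (hd : 1 ≤ d) :
    (∃ C₁ C₂ C₃ C₄ : ℝ, 0 < C₁ ∧ 0 < C₂ ∧ 0 < C₃ ∧ 0 < C₄ ∧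
      ∀ L : ℕ, 2 ≤ L → ∀ bc : CubeBC d L, ∀ p : ℝ, 0 < p → p < 1 →
        1 - 3 * Real.exp (-(C₂ * p * (L : ℝ) ^ d)) - C₃ * (L : ℝ) ^ (-C₄) ≤
          cubeDropletProb bc p
            (C₁ * (1 - p) * √p * (L : ℝ) ^ d * (Real.log L) ^ (-(1 / 2) : ℝ))) ∧
    (∀ ε : ℝ, 0 < ε → ∃ K : ℝ, 0 < K ∧
      ∀ L : ℕ, 2 ≤ L → ∀ bc : CubeBC d L, ∀ p : ℝ, 0 < p → p < 1 → K / (L : ℝ) ≤ p →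
        1 - ε ≤
          cubeDropletProb bc p
            ((L : ℝ) ^ ((d : ℝ) - 1 / 2) * (Real.log L) ^ (-(1 / 2) : ℝ))) := by
  obtain ⟨C₁, C₂, C₃, h₁, h₂, h₃, h⟩ := exists_le_cubeDropletProb d hd
  refine ⟨⟨C₁, C₂, C₃, 1, h₁, h₂, h₃, one_pos, ?_⟩, ?_⟩
  · intro L hL bc p hp hp1
    have hlog : 0 ≤ Real.log L := Real.log_natCast_nonneg L
    have hq : 1 - p ≤ 1 := by linarith
    refine le_trans ?_ (h L hL bc p hp hp1 _ ?_)
    · rw [Real.rpow_neg_one, ← div_eq_mul_inv]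
      linarith [Real.exp_pos (-(C₂ * p * (L : ℝ) ^ d))]
    · gcongr
      exact mul_le_of_le_one_right h₁.le hq
  · intro ε hε
    -- The three summands give, in order, `C₁ √(pL) ≥ 1`, an exponential term of at most `ε / 4` (it
    -- is counted twice), and `C₃ / L ≤ ε / 2`.
    refine ⟨1 / C₁ ^ 2 + 4 / (C₂ * ε) + 2 * C₃ / ε, by positivity, ?_⟩
    intro L hL bc p hp hp1 hK
    set K := 1 / C₁ ^ 2 + 4 / (C₂ * ε) + 2 * C₃ / ε with hKdef
    have k₁ : 0 < 1 / C₁ ^ 2 := by positivity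
    have k₂ : 0 < 4 / (C₂ * ε) := by positivity
    have k₃ : 0 < 2 * C₃ / ε := by positivity
    have hL0 : (0 : ℝ) < L := by positivity
    have hL1 : (1 : ℝ) ≤ L := by exact_mod_cast (by omega : 1 ≤ L)
    have hKp : K ≤ p * L := (div_le_iff₀ hL0).1 hK
    have hKL : K ≤ L := hKp.trans (by nlinarith)
    have hlog : 0 ≤ Real.log L := Real.log_natCast_nonneg L
    refine le_trans ?_ (h L hL bc p hp hp1 _ ?_)
    · have hLd : (L : ℝ) ≤ (L : ℝ) ^ d := le_self_pow₀ hL1 (by omega)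
      have b₁ : Real.exp (-(C₂ * p * (L : ℝ) ^ d)) ≤ 1 / (4 / ε) := by
        refine exp_neg_le_inv (by positivity) ?_
        calc 4 / ε = C₂ * (4 / (C₂ * ε)) := by field_simp
          _ ≤ C₂ * (p * L) := by
            gcongr
            linarith
          _ ≤ C₂ * (p * (L : ℝ) ^ d) := by gcongr
          _ = _ := by ring
      have b₂ : C₃ / L ≤ ε / 2 := by
        rw [div_le_iff₀ hL0]
        calc C₃ = ε / 2 * (2 * C₃ / ε) := by field_simp
          _ ≤ ε / 2 * L := by
            gcongr
            linarith
      rw [one_div_div] at b₁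
      linarith
    · gcongr
      have hsplit : (L : ℝ) ^ ((d : ℝ) - 1 / 2) = (L : ℝ) ^ d / √L := by
        rw [Real.rpow_sub hL0, Real.rpow_natCast, Real.sqrt_eq_rpow]
      rw [hsplit, div_le_iff₀ (Real.sqrt_pos.2 hL0)]
      have hone : 1 ≤ C₁ * √p * √L := by
        rw [mul_assoc, ← Real.sqrt_mul hp.le]
        have : 1 / C₁ ≤ √(p * L) := by
          apply Real.le_sqrt_of_sq_le
          rw [div_pow, one_pow]
          linarith
        calc 1 = C₁ * (1 / C₁) := by field_simp
          _ ≤ _ := by gcongr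
      calc (L : ℝ) ^ d = 1 * (L : ℝ) ^ d := (one_mul _).symm
        _ ≤ C₁ * √p * √L * (L : ℝ) ^ d := by gcongr
        _ = _ := by ring
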